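/- Let $L=(L_t)_{t\ge 0}$ be a real-valued Lévy process on a probability space $(\Omega,\mathcal F,\mathbf P)$, that is, $L_0=0$ almost surely, $L$ has independent and stationary increments, is stochastically continuous, and almost surely has càdlàg paths. Let $A>0$ and, for every $\gamma\ge 0$, let $(V^\gamma,X^\gamma)$ be the solution (with paths of $V^\gamma$ almost surely integrable on bounded time intervals) of the integrated Ornstein--Uhlenbeck (Langevin) system $$V^\gamma_t=-\gamma A\int_0^t V^\gamma_s\,\mathrm ds+L_t,\qquad X^\gamma_t=\gamma\int_0^t V^\gamma_s\,\mathrm ds,\qquad t\ge 0,$$ understood to hold almost surely for all $t\ge 0$ simultaneously. Then for any $m\ge 1$ and any times $0\le t_1<\dots<t_m<\infty$, $$\bigl(AX^\gamma_{t_1},\dots,AX^\gamma_{t_m}\bigr)\longrightarrow\bigl(L_{t_1},\dots,L_{t_m}\bigr)\quad\text{in probability in }\mathbb R^m\text{ as }\gamma\to\infty .$$ -/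

import Mathlib

open MeasureTheory ProbabilityTheory Filter Topology
open scoped NNReal

/-- A path `x : [0,∞) → ℝ` is càdlàg: right-continuous at every `t ≥ 0`, with a finite left limit at
every `t > 0` (at `t = 0` the filter `𝓝[<] 0` is trivial, so nothing is required there). -/
def IsCadlagPath (x : ℝ≥0 → ℝ) : Prop :=
  ∀ t : ℝ≥0, ContinuousWithinAt x (Set.Ici t) t ∧ ∃ l : ℝ, Tendsto x (𝓝[<] t) (𝓝 l)

/-- A real-valued Lévy process `L = (L_t)_{t ≥ 0}` on `(Ω, P)`: it starts at the origin, has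
independent and stationary increments, is stochastically continuous and has càdlàg paths. -/
structure IsLevyProcess {Ω : Type*} [MeasurableSpace Ω] (P : Measure Ω)
    (L : ℝ≥0 → Ω → ℝ) : Prop where
  measurable : ∀ t, Measurable (L t)
  start_zero : ∀ᵐ ω ∂P, L 0 ω = 0
  indep_increments : HasIndepIncrements L P
  stationary_increments : ∀ s h : ℝ≥0, IdentDistrib (L (s + h) - L s) (L h) P P
  stochastically_continuous : ∀ t : ℝ≥0, TendstoInMeasure P L (𝓝 t) (L t)
  cadlag : ∀ᵐ ω ∂P, IsCadlagPath fun t => L t ω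

/-- `(V, X)` solves the Langevin system driven by `L`, with zero initial conditions:
almost surely, for all `t ≥ 0`,
`V_t = -γ A ∫₀ᵗ V_s ds + L_t` and `X_t = γ ∫₀ᵗ V_s ds`,
where the paths of `V` are integrable on every `[0, t]`. The integration variable `s` is
nonnegative on `[0, t]`, so `s.toNNReal` is just `s` seen as an element of `[0, ∞)`. -/
structure IsLangevinSolution {Ω : Type*} [MeasurableSpace Ω] (P : Measure Ω)
    (A γ : ℝ) (L V X : ℝ≥0 → Ω → ℝ) : Prop where
  integrable : ∀ᵐ ω ∂P, ∀ t : ℝ≥0,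
    IntervalIntegrable (fun s : ℝ => V s.toNNReal ω) volume 0 (t : ℝ)
  velocity : ∀ᵐ ω ∂P, ∀ t : ℝ≥0,
    V t ω = -(γ * A) * (∫ s in (0 : ℝ)..(t : ℝ), V s.toNNReal ω) + L t ω
  displacement : ∀ᵐ ω ∂P, ∀ t : ℝ≥0,
    X t ω = γ * ∫ s in (0 : ℝ)..(t : ℝ), V s.toNNReal ω

/-! With `a = γ * A` and `I` the integral of `V`, the process `A * X = a * I` solves `(a * I)' = a *
(L - a * I)`: it is `L` smoothed exponentially with relaxation time `1 / a`. Almost surely `L` has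
no jump at the fixed time `t`, so `|L s - L t| ≤ ε + K * (t - s)` for `s ≤ t` with a random finite
`K`, and smoothing then costs at most `ε + K / a` (`abs_mul_integral_sub_le`). Off an event of small
probability one deterministic `K` serves, and `γ → ∞` removes `K / a`. -/

/-- A path with one-sided limits is bounded on every compact interval `[0, t]`. -/
theorem IsCadlagPath.exists_abs_le {x : ℝ≥0 → ℝ} (hx : IsCadlagPath x) (t : ℝ≥0) :
    ∃ C : ℝ, ∀ s ≤ t, |x s| ≤ C := by
  have key : ∃ C : ℝ, ∀ s ∈ Set.Icc 0 t, |x s| ≤ C := by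
    refine (isCompact_Icc : IsCompact (Set.Icc (0 : ℝ≥0) t)).induction_on
      (p := fun S => ∃ C : ℝ, ∀ s ∈ S, |x s| ≤ C) ⟨0, by simp⟩ ?_ ?_ ?_
    · rintro S T hST ⟨C, hC⟩
      exact ⟨C, fun s hs => hC s (hST hs)⟩
    · rintro S T ⟨C, hC⟩ ⟨D, hD⟩
      refine ⟨max C D, ?_⟩
      rintro s (hs | hs)
      · exact (hC s hs).trans (le_max_left _ _)
      · exact (hD s hs).trans (le_max_right _ _)
    · intro r _
      obtain ⟨hr, l, hl⟩ := hx r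
      have h1 : ∀ᶠ s in 𝓝[≥] r, |x s| < |x r| + |l| + 1 :=
        hr.tendsto.abs.eventually_lt_const (by linarith [abs_nonneg l])
      have h2 : ∀ᶠ s in 𝓝[<] r, |x s| < |x r| + |l| + 1 :=
        hl.abs.eventually_lt_const (by linarith [abs_nonneg (x r)])
      have h3 : ∀ᶠ s in 𝓝 r, |x s| < |x r| + |l| + 1 := by
        rw [← nhdsLT_sup_nhdsGE]
        exact Filter.eventually_sup.mpr ⟨h2, h1⟩
      exact ⟨_, mem_nhdsWithin_of_mem_nhds h3, _, fun s hs => le_of_lt hs⟩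
  obtain ⟨C, hC⟩ := key
  exact ⟨C, fun s hs => hC s ⟨zero_le, hs⟩⟩

/-- If a càdlàg path does not jump at `t`, its oscillation before `t` is at most affine in the
distance to `t`, with arbitrarily small constant term. -/
theorem IsCadlagPath.exists_affine_bound {x : ℝ≥0 → ℝ} (hx : IsCadlagPath x) {t : ℝ≥0}
    (hleft : Tendsto x (𝓝[<] t) (𝓝 (x t))) {ε : ℝ} (hε : 0 < ε) :
    ∃ K : ℕ, ∀ s ≤ t, |x s - x t| ≤ ε + K * ((t : ℝ) - s) := by
  obtain ⟨C, hC⟩ := hx.exists_abs_le t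
  have hC0 : 0 ≤ C := (abs_nonneg _).trans (hC t le_rfl)
  have hcont : Tendsto x (𝓝[≤] t) (𝓝 (x t)) :=
    continuousWithinAt_Iio_iff_Iic.mp hleft
  obtain ⟨δ, hδ, hclose⟩ := Metric.tendsto_nhdsWithin_nhds.mp hcont ε hε
  -- At distance at least `δ` from `t`, the crude bound `2 * C` is absorbed by the slope.
  obtain ⟨K, hK⟩ := exists_nat_ge (2 * C / δ)
  refine ⟨K, fun s hs => ?_⟩
  have hst : (0 : ℝ) ≤ (t : ℝ) - s := sub_nonneg.mpr (by exact_mod_cast hs)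
  by_cases hd : (t : ℝ) - s < δ
  · have := hclose (x := s) hs (by
      rw [NNReal.dist_eq, abs_sub_comm, abs_of_nonneg hst]; exact hd)
    rw [Real.dist_eq] at this
    have : 0 ≤ (K : ℝ) * ((t : ℝ) - s) := by positivity
    linarith
  · rw [not_lt] at hd
    have h1 : 2 * C ≤ K * δ := (div_le_iff₀ hδ).mp hK
    have h2 : (K : ℝ) * δ ≤ K * ((t : ℝ) - s) := by gcongr
    have h3 : |x s - x t| ≤ |x s| + |x t| := abs_sub _ _
    linarith [hC s hs, hC t le_rfl]

/-- For a right-continuous path, an affine oscillation bound can be tested on a dense set. -/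
theorem IsCadlagPath.affine_bound_of_dense {x : ℝ≥0 → ℝ} (hx : IsCadlagPath x) {t : ℝ≥0}
    {D : Set ℝ≥0} (hD : Dense D) {ε K : ℝ} (hε : 0 < ε)
    (h : ∀ q ∈ D, q ≤ t → |x q - x t| ≤ ε + K * ((t : ℝ) - q)) :
    ∀ s ≤ t, |x s - x t| ≤ ε + K * ((t : ℝ) - s) := by
  intro s hs
  rcases hs.eq_or_lt with rfl | hs
  · simpa using hε.le
  by_contra! hlt
  have hc : ContinuousWithinAt (fun q : ℝ≥0 => |x q - x t| - (ε + K * ((t : ℝ) - q)))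
      (Set.Ici s) s := by
    have := (hx s).1
    have h2 : Continuous fun q : ℝ≥0 => ε + K * ((t : ℝ) - q) := by fun_prop
    exact (this.sub continuousWithinAt_const).abs.sub h2.continuousWithinAt
  have hev : ∀ᶠ q in 𝓝[≥] s, 0 < |x q - x t| - (ε + K * ((t : ℝ) - q)) :=
    hc.tendsto.eventually_const_lt (by linarith)
  obtain ⟨u, hu, hsub⟩ := (mem_nhdsGE_iff_exists_Ico_subset' hs).mp hev
  obtain ⟨q, hqD, hq⟩ := hD.exists_between (lt_min hu hs)
  have h1 : 0 < |x q - x t| - (ε + K * ((t : ℝ) - q)) :=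
    hsub ⟨hq.1.le, hq.2.trans_le (min_le_left _ _)⟩
  linarith [h q hqD (hq.2.le.trans (min_le_right _ _))]

/-- Relaxation estimate for `v = ℓ - a ∫ v`: the function `a ∫ v` follows the input `ℓ`. -/
theorem abs_mul_integral_sub_le {v l : ℝ → ℝ} {a ε K t : ℝ} (ha : 0 < a) (hK : 0 ≤ K) (ht : 0 ≤ t)
    (hint : ∀ s, 0 ≤ s → IntervalIntegrable v volume 0 s)
    (hv : ∀ s, 0 ≤ s → v s = -a * (∫ r in (0 : ℝ)..s, v r) + l s)
    (hl : ∀ s, 0 ≤ s → ContinuousWithinAt l (Set.Ici s) s) (hl0 : l 0 = 0)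
    (hb : ∀ s, 0 ≤ s → s ≤ t → |l s - l t| ≤ ε + K * (t - s)) :
    |a * (∫ r in (0 : ℝ)..t, v r) - l t| ≤ ε + K / a := by
  set I : ℝ → ℝ := fun s => ∫ r in (0 : ℝ)..s, v r with hI
  have hIcont : ∀ b, 0 ≤ b → ContinuousOn I (Set.Icc 0 b) := fun b h0 => by
    have := intervalIntegral.continuousOn_primitive_interval' (hint b h0) Set.left_mem_uIcc
    rwa [Set.uIcc_of_le h0] at this
  have hIder : ∀ s, 0 ≤ s → HasDerivWithinAt I (v s) (Set.Ici s) s := fun s hs => by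
    have hnhds : Set.Icc s (s + 1) ∈ 𝓝[≥] s := Icc_mem_nhdsGE (by linarith)
    -- The equation makes `v` right-continuous, hence the right derivative of `I` everywhere.
    have hvc : ContinuousWithinAt v (Set.Ici s) s := by
      have hIc : ContinuousWithinAt I (Set.Ici s) s := by
        have := (hIcont (s + 1) (by linarith)) s ⟨hs, by linarith⟩
        exact (this.mono (Set.Icc_subset_Icc_left hs)).mono_of_mem_nhdsWithin hnhds
      exact ((continuousWithinAt_const.mul hIc).add (hl s hs)).congr
        (fun r hr => hv r (hs.trans hr)) (hv s hs)
    refine intervalIntegral.integral_hasDerivWithinAt_right (hint s hs) (t := Set.Ioi s) ?_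
      (hvc.mono Set.Ioi_subset_Ici_self)
    refine ⟨Set.Ioc s (s + 1), Ioc_mem_nhdsGT (by linarith), ?_⟩
    exact ((hint (s + 1) (by linarith)).1.mono_set
      (Set.Ioc_subset_Ioc_left hs)).aestronglyMeasurable
  have hexp : ∀ s, HasDerivAt (fun s => Real.exp (a * s)) (Real.exp (a * s) * a) s := fun s => by
    simpa using ((hasDerivAt_id s).const_mul a).exp
  have hfcont : ContinuousOn (fun s => Real.exp (a * s) * (a * I s - l t)) (Set.Icc 0 t) :=
    (by fun_prop : Continuous fun s => Real.exp (a * s)).continuousOn.mul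
      ((continuousOn_const.mul (hIcont t ht)).sub continuousOn_const)
  -- The factor `exp (a * s)` turns the derivative into `a * exp (a * s) * (l s - l t)`. The term `K
  -- / a` in `B` offsets the slope `-K`.
  have hmain := image_norm_le_of_norm_deriv_right_le_deriv_boundary
    (f' := fun s => Real.exp (a * s) * a * (a * I s - l t) + Real.exp (a * s) * (a * v s))
    (B := fun s => Real.exp (a * s) * (ε + K * (t - s) + K / a))
    (B' := fun s => Real.exp (a * s) * a * (ε + K * (t - s) + K / a)
      + Real.exp (a * s) * (K * (-1))) hfcont ?_ ?_ ?_ ?_ (Set.right_mem_Icc.mpr ht)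
  · simp only [Real.norm_eq_abs, abs_mul, Real.abs_exp, sub_self, mul_zero, add_zero] at hmain
    exact le_of_mul_le_mul_left hmain (Real.exp_pos _)
  · intro s hs
    exact (hexp s).hasDerivWithinAt.mul (((hIder s hs.1).const_mul a).sub_const _)
  · have h0 := hb 0 le_rfl ht
    have : 0 ≤ K / a := by positivity
    simp only [hI, intervalIntegral.integral_same, Real.norm_eq_abs, mul_zero, Real.exp_zero,
      one_mul]
    rw [hl0] at h0
    linarith
  · intro s
    refine (hexp s).mul ?_
    exact ((((hasDerivAt_id s).const_sub t).const_mul K).const_add ε).add_const _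
  · intro s hs
    have e1 : Real.exp (a * s) * a * (a * I s - l t) + Real.exp (a * s) * (a * v s)
        = Real.exp (a * s) * a * (l s - l t) := by
      rw [hv s hs.1]; ring
    have e2 : Real.exp (a * s) * a * (ε + K * (t - s) + K / a) + Real.exp (a * s) * (K * (-1))
        = Real.exp (a * s) * a * (ε + K * (t - s)) := by
      field_simp; ring
    rw [e1, e2, Real.norm_eq_abs, abs_mul, abs_of_pos (by positivity : 0 < Real.exp (a * s) * a)]
    exact mul_le_mul_of_nonneg_left (hb s hs.1 hs.2.le) (by positivity)

/-- A Lévy process almost surely has no jump at a fixed time. -/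
theorem IsLevyProcess.ae_tendsto_left {Ω : Type*} [MeasurableSpace Ω] {P : Measure Ω}
    {L : ℝ≥0 → Ω → ℝ} (hL : IsLevyProcess P L) (t : ℝ≥0) :
    ∀ᵐ ω ∂P, Tendsto (fun s => L s ω) (𝓝[<] t) (𝓝 (L t ω)) := by
  rcases eq_zero_or_pos t with rfl | ht
  · simp
  have : (𝓝[<] t).NeBot := nhdsLT_neBot_of_exists_lt ⟨0, ht⟩
  have hmeas : TendstoInMeasure P L (𝓝[<] t) (L t) := fun ε hε =>
    (hL.stochastically_continuous t ε hε).mono_left nhdsWithin_le_nhds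
  obtain ⟨ns, hns, hlim⟩ := hmeas.exists_seq_tendsto_ae'
  filter_upwards [hlim, hL.cadlag] with ω h1 h2
  obtain ⟨l, hl⟩ := (h2 t).2
  -- The left limit exists, so an almost surely convergent sequence of times identifies it.
  rwa [tendsto_nhds_unique h1 (hl.comp hns)]

/-- Tightness of the oscillation constant of a Lévy process before a fixed time, tested on a
countable dense set of times. -/
theorem IsLevyProcess.tendsto_measure_not_affine_bound {Ω : Type*} [MeasurableSpace Ω]
    {P : Measure Ω} [IsFiniteMeasure P] {L : ℝ≥0 → Ω → ℝ} (hL : IsLevyProcess P L) (t : ℝ≥0)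
    {D : Set ℝ≥0} (hD : D.Countable) {ε : ℝ} (hε : 0 < ε) :
    Tendsto (fun K : ℕ =>
      P {ω | ∀ q ∈ D, q ≤ t → |L q ω - L t ω| ≤ ε + K * ((t : ℝ) - q)}ᶜ) atTop (𝓝 0) := by
  set E : ℕ → Set Ω := fun K => {ω | ∀ q ∈ D, q ≤ t → |L q ω - L t ω| ≤ ε + K * ((t : ℝ) - q)}
    with hE
  -- Countability of `D` gives the measurability needed for continuity from above.
  have hmeas : ∀ K, MeasurableSet (E K) := fun K => by
    have : E K = ⋂ q ∈ D, ⋂ _ : q ≤ t, {ω | |L q ω - L t ω| ≤ ε + K * ((t : ℝ) - q)} := by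
      ext ω; simp [hE]
    rw [this]
    refine MeasurableSet.biInter hD fun q _ => MeasurableSet.iInter fun _ => ?_
    exact measurableSet_le ((hL.measurable q).sub (hL.measurable t)).abs measurable_const
  have hanti : Antitone fun K => (E K)ᶜ := fun K K' hKK => by
    refine Set.compl_subset_compl.mpr fun ω hω q hq hqt => (hω q hq hqt).trans ?_
    have : (0 : ℝ) ≤ (t : ℝ) - q := sub_nonneg.mpr (by exact_mod_cast hqt)
    gcongr
  have hnull : P (⋂ K, (E K)ᶜ) = 0 := by
    rw [← Set.compl_iUnion, ← mem_ae_iff]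
    filter_upwards [hL.cadlag, hL.ae_tendsto_left t] with ω h1 h2
    obtain ⟨K, hK⟩ := h1.exists_affine_bound h2 hε
    exact Set.mem_iUnion.mpr ⟨K, fun q _ hq => hK q hq⟩
  have := tendsto_measure_iInter_atTop (μ := P) (fun K => (hmeas K).compl.nullMeasurableSet) hanti
    ⟨0, measure_ne_top _ _⟩
  rwa [hnull] at this

/-- Pathwise comparison of the rescaled displacement with the driving process. -/
theorem IsLangevinSolution.ae_abs_sub_le {Ω : Type*} [MeasurableSpace Ω] {P : Measure Ω}
    {A γ : ℝ} (hA : 0 < A) (hγ : 0 < γ) {L V X : ℝ≥0 → Ω → ℝ} (hL : IsLevyProcess P L)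
    (h : IsLangevinSolution P A γ L V X) (t : ℝ≥0) {D : Set ℝ≥0} (hD : Dense D) {ε : ℝ}
    (hε : 0 < ε) (K : ℕ) :
    ∀ᵐ ω ∂P, (∀ q ∈ D, q ≤ t → |L q ω - L t ω| ≤ ε + K * ((t : ℝ) - q)) →
      |A * X t ω - L t ω| ≤ ε + K / (γ * A) := by
  filter_upwards [h.integrable, h.velocity, h.displacement, hL.cadlag, hL.start_zero]
    with ω hint hvel hdis hcad h0 hbound
  have hbound' := hcad.affine_bound_of_dense hD hε hbound
  have key := abs_mul_integral_sub_le (v := fun s => V s.toNNReal ω)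
    (l := fun s => L s.toNNReal ω) (a := γ * A) (ε := ε) (K := K) (t := t) (by positivity)
    (by positivity) t.2 (fun s hs => by simpa [hs] using hint s.toNNReal)
    (fun s hs => by simpa [hs] using hvel s.toNNReal) (fun s hs => ?_) (by simpa using h0)
    (fun s hs hst => by
      have := hbound' s.toNNReal (Real.toNNReal_le_iff_le_coe.mpr hst)
      simpa [hs] using this)
  · simp only [Real.toNNReal_coe] at key
    rw [hdis t, show A * (γ * ∫ s in (0 : ℝ)..(t : ℝ), V s.toNNReal ω)
      = γ * A * ∫ s in (0 : ℝ)..(t : ℝ), V s.toNNReal ω by ring]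
    exact key
  · exact (hcad s.toNNReal).1.comp (f := Real.toNNReal)
      continuous_real_toNNReal.continuousWithinAt fun r hr => Real.toNNReal_le_toNNReal hr

/-- Convergence in probability at a single time. -/
theorem tendstoInMeasure_displacement {Ω : Type*} [MeasurableSpace Ω] {P : Measure Ω}
    [IsFiniteMeasure P] {L : ℝ≥0 → Ω → ℝ} (hL : IsLevyProcess P L) {A : ℝ} (hA : 0 < A)
    {V X : ℝ → ℝ≥0 → Ω → ℝ}
    (hVX : ∀ γ : ℝ, 0 ≤ γ → IsLangevinSolution P A γ L (V γ) (X γ)) (t : ℝ≥0) :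
    TendstoInMeasure P (fun (γ : ℝ) (ω : Ω) => A * X γ t ω) atTop (L t) := by
  rw [tendstoInMeasure_iff_norm]
  intro ε hε
  obtain ⟨D, hDc, hDd⟩ := TopologicalSpace.exists_countable_dense ℝ≥0
  rw [ENNReal.tendsto_nhds_zero]
  intro η hη
  -- `K` is fixed before `γ`; half of `ε` is kept for `K / (γ * A)`.
  obtain ⟨K, hK⟩ := ((ENNReal.tendsto_nhds_zero.mp
    (hL.tendsto_measure_not_affine_bound t hDc (half_pos hε))) η hη).exists
  have hsmall : Tendsto (fun γ : ℝ => (K : ℝ) / (γ * A)) atTop (𝓝 0) :=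
    tendsto_const_nhds.div_atTop (tendsto_id.atTop_mul_const hA)
  filter_upwards [hsmall.eventually_lt_const (half_pos hε), eventually_gt_atTop 0] with γ hγ hγ0
  refine (measure_mono_ae ?_).trans hK
  filter_upwards [(hVX γ hγ0.le).ae_abs_sub_le hA hγ0 hL t hDd (half_pos hε) K] with ω hω hmem hgood
  have h1 : ε ≤ |A * X γ t ω - L t ω| := hmem
  linarith [hω hgood]

/-- Convergence in measure of finitely many coordinates implies joint convergence. -/
theorem TendstoInMeasure.of_forall_apply {Ω ι κ : Type*} [MeasurableSpace Ω] [Fintype κ]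
    {E : κ → Type*} [∀ i, PseudoEMetricSpace (E i)] {P : Measure Ω} {l : Filter ι}
    {f : ι → Ω → ∀ i, E i} {g : Ω → ∀ i, E i}
    (h : ∀ i, TendstoInMeasure P (fun j ω => f j ω i) l (fun ω => g ω i)) :
    TendstoInMeasure P f l g := by
  intro ε hε
  have hsum : Tendsto (fun j => ∑ i, P {ω | ε ≤ edist (f j ω i) (g ω i)}) l (𝓝 0) := by
    simpa using tendsto_finsetSum Finset.univ fun i _ => h i ε hε
  refine tendsto_of_tendsto_of_tendsto_of_le_of_le tendsto_const_nhds hsum (fun _ => zero_le)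
    fun j => ?_
  refine (measure_mono fun ω hω => ?_).trans (measure_iUnion_fintype_le P _)
  by_contra hne
  simp only [Set.mem_iUnion, Set.mem_ofPred_eq, not_exists, not_le] at hne
  have hle : ε ≤ edist (f j ω) (g ω) := hω
  refine absurd hle (not_le.mpr ?_)
  -- Positivity of `ε` covers an empty index type.
  rw [edist_pi_def, Finset.sup_lt_iff hε]
  exact fun i _ => hne i

theorem mainTheorem5 {Ω : Type*} [MeasurableSpace Ω] (P : Measure Ω) [IsProbabilityMeasure P]
    (L : ℝ≥0 → Ω → ℝ) (hL : IsLevyProcess P L)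
    (A : ℝ) (hA : 0 < A)
    (V X : ℝ → ℝ≥0 → Ω → ℝ)
    (hVX : ∀ γ : ℝ, 0 ≤ γ → IsLangevinSolution P A γ L (V γ) (X γ))
    (m : ℕ) (t : Fin m → ℝ≥0) (ht : StrictMono t) :
    TendstoInMeasure P (fun (γ : ℝ) (ω : Ω) (i : Fin m) => A * X γ (t i) ω) atTop
      (fun (ω : Ω) (i : Fin m) => L (t i) ω) :=
  TendstoInMeasure.of_forall_apply fun i => tendstoInMeasure_displacement hL hA hVX (t i)
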